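/- Let $n,d,k\ge 0$ be integers with $2k\le d$, let $R=\mathbb{C}[x_0,\dots,x_n]$ with its usual grading, and let $R_i$ be the space of homogeneous polynomials of degree $i$ (together with $0$). For $f\in R_d$ let $J^k(f)\subset R$ be the ideal generated by all partial derivatives of $f$ of order $k$, let $M^k(f)=R/J^k(f)$ be the $k$-th order Milnor algebra, and put $h_i(M^k(f))=\dim_{\mathbb{C}}M^k(f)_i$. There is a nonempty Zariski open subset $U_{d,k}$ of the affine space $R_d$ such that the Hilbert vector $(h_i(M^k(f)))_{i\ge 0}$ is the same for all $f\in U_{d,k}$. For every such $U_{d,k}$ and every $f\in U_{d,k}$ one has $$h_i(M^k(f))=\binom{n+i}{n}\quad\text{for } 0\le i<d-k$$ and $$h_{d-k}(M^k(f))=\dim R_{d-k}-\dim R_k=\binom{n+d-k}{n}-\binom{n+k}{n}.$$ In particular, if $n\ge 1$ and $k\ge 2$ (so that $d\ge 2k\ge 4$), then the Fermat polynomial $x_0^d+\dots+x_n^d$ does not belong to $U_{d,k}$. -/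

import Mathlib

namespace HigherMilnor

open MvPolynomial

/-- The polynomial ring `R = ℂ[x₀, …, xₙ]`. -/
abbrev Poly (n : ℕ) : Type := MvPolynomial (Fin (n + 1)) ℂ

/-- `R_d`, the complex vector space of homogeneous polynomials of degree `d` (with `0`). -/
noncomputable abbrev Forms (n d : ℕ) : Submodule ℂ (Poly n) := homogeneousSubmodule (Fin (n + 1)) ℂ d

/-- The set of all partial derivatives `∂ᵏf / ∂x_{i₁} ⋯ ∂x_{iₖ}` of order exactly `k`. -/
def kthPartials {n : ℕ} (f : Poly n) : ℕ → Set (Poly n)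
  | 0 => {f}
  | k + 1 => {g | ∃ i : Fin (n + 1), ∃ h ∈ kthPartials f k, g = pderiv i h}

/-- The `k`-th order Jacobian ideal `Jᵏ(f)`: the ideal of `R` generated by the partial
derivatives of order `k` of `f`. -/
noncomputable def jacobianIdeal {n : ℕ} (k : ℕ) (f : Poly n) : Ideal (Poly n) :=
  Ideal.span (kthPartials f k)

/-- The `k`-th order Milnor algebra `Mᵏ(f) = R / Jᵏ(f)`. -/
abbrev MilnorAlgebra {n : ℕ} (k : ℕ) (f : Poly n) : Type := Poly n ⧸ jacobianIdeal k f

/-- The degree `i` part of `Mᵏ(f)`, that is, the image of `R_i`. -/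
noncomputable def milnorPart {n : ℕ} (k : ℕ) (f : Poly n) (i : ℕ) : Submodule ℂ (MilnorAlgebra k f) :=
  (Forms n i).map (Ideal.Quotient.mkₐ ℂ (jacobianIdeal k f)).toLinearMap

/-- `h_i(Mᵏ(f)) = dim Mᵏ(f)_i`; as a function of `i` this is the Hilbert vector of `Mᵏ(f)`.
(Each graded part is an image of `R_i`, hence finite dimensional.) -/
noncomputable def hilb {n : ℕ} (k : ℕ) (f : Poly n) (i : ℕ) : ℕ :=
  Module.finrank ℂ (milnorPart k f i)

/-- The exponents of the monomials of degree `d`; they index the coordinates of `R_d`. -/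
abbrev Exponents (n d : ℕ) : Type := {m : Fin (n + 1) →₀ ℕ // m.degree = d}

/-- Zariski open subsets of the affine space `R_d`, whose coordinates are the coefficients of a
form: complements of the common zero sets of families of polynomials in the coefficients. -/
def IsZariskiOpen {n d : ℕ} (U : Set (Forms n d)) : Prop :=
  ∃ S : Set (MvPolynomial (Exponents n d) ℂ),
    ∀ f : Forms n d, f ∈ U ↔ ∃ P ∈ S, eval (fun m => coeff m.1 (f : Poly n)) P ≠ 0

/-- `U` can serve as `U_{d,k}`: a nonempty Zariski open subset of `R_d` on which the Hilbert
vector of `Mᵏ(f)` is constant. -/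
def IsGenericLocus {n d : ℕ} (k : ℕ) (U : Set (Forms n d)) : Prop :=
  IsZariskiOpen U ∧ U.Nonempty ∧
    ∀ f ∈ U, ∀ g ∈ U, hilb k (f : Poly n) = hilb k (g : Poly n)

/-- The Fermat form `x₀ᵈ + ⋯ + xₙᵈ`. -/
noncomputable def fermat (n d : ℕ) : Forms n d :=
  ⟨∑ i : Fin (n + 1), X i ^ d,
    Submodule.sum_mem _ fun i _ => (mem_homogeneousSubmodule d _).2 (isHomogeneous_X_pow i d)⟩

end HigherMilnor

open HigherMilnor

/-!
The rank of a finite family of vectors depending linearly on `f` is lower semicontinuous in `f`,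
so each `dim Jᵏ(f)_i` takes its largest value on a nonempty Zariski open set. For `1 ≤ k ≤ d` the
ideal `Jᵏ` of the Fermat form contains a power of every variable, hence all forms of some degree
`N`; a form with maximal rank in degree `N` then also has `R_N ⊆ Jᵏ(f)`, so only the degrees `≤ N`
have to be intersected.

The space `Jᵏ(f)_{d-k}` is spanned by the partial derivatives of order `k`. For one form `f` with
`d = 2k + e` these are independent: let `f` be the form representing the functional
`φ(g) = ∑_p g(p)`, where `p` runs over a grid of positive integer points. A relation between the
derivatives is a form `q` of degree `k` with `φ(q g) = 0` for all `g` of degree `k + e`, and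
`g = q̄ x₀ᵉ` gives `∑_p |q(p)|² p₀ᵉ = 0`, so `q` vanishes on the grid and therefore is zero.
-/

namespace HigherMilnor

open MvPolynomial Module

section HomogeneousPolynomials

variable (σ R : Type*) [CommSemiring R]

/-- The basis of the space of forms of degree `d` given by the monomials of degree `d`; its
coordinates are the coefficients. -/
noncomputable def homogeneousBasis (d : ℕ) :
    Basis {m : σ →₀ ℕ // m.degree = d} R (homogeneousSubmodule σ R d) :=
  (basisRestrictSupport R {m : σ →₀ ℕ | m.degree = d}).map
    (LinearEquiv.ofEq _ _ (homogeneousSubmodule_eq_finsupp_supported σ R d).symm)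

theorem homogeneousSubmodule_eq_span_monomial (d : ℕ) :
    homogeneousSubmodule σ R d =
      Submodule.span R ((fun m => monomial m 1) '' {m : σ →₀ ℕ | m.degree = d}) := by
  rw [homogeneousSubmodule_eq_finsupp_supported]
  exact restrictSupport_eq_span R _

variable {σ R}

@[simp]
theorem coe_homogeneousBasis_apply {d : ℕ} (m : {m : σ →₀ ℕ // m.degree = d}) :
    (homogeneousBasis σ R d m : MvPolynomial σ R) = monomial m.1 1 := by
  classical
  suffices homogeneousBasis σ R d m = ⟨monomial m.1 1, isHomogeneous_monomial 1 m.2⟩ from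
    congrArg Subtype.val this
  rw [Basis.apply_eq_iff]
  ext m'
  change coeff m'.1 (monomial m.1 1) = _
  simp [coeff_monomial, Finsupp.single_apply, Subtype.ext_iff]

instance finite_degree_eq [Finite σ] (d : ℕ) : Finite {m : σ →₀ ℕ // m.degree = d} :=
  Finsupp.finite_of_degree_eq d

instance finite_homogeneousSubmodule [Finite σ] (d : ℕ) :
    Module.Finite R (homogeneousSubmodule σ R d) :=
  Module.Finite.iff_fg.2 (homogeneousSubmodule_fg σ R d)

theorem finrank_homogeneousSubmodule [Fintype σ] [StrongRankCondition R] (d : ℕ) :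
    finrank R (homogeneousSubmodule σ R d) = (Fintype.card σ + d - 1).choose d := by
  classical
  rw [finrank_eq_nat_card_basis (homogeneousBasis σ R d),
    ← Sym.card_sym_eq_choose, ← Nat.card_eq_fintype_card]
  exact Nat.card_congr (Sym.equivNatSum σ d).symm

theorem finrank_forms (n d : ℕ) : finrank ℂ (Forms n d) = (n + d).choose n := by
  rw [finrank_homogeneousSubmodule, Fintype.card_fin, Nat.add_right_comm, Nat.add_sub_cancel,
    Nat.choose_symm_add]

theorem homogeneousSubmodule_le_iff_pow_idealOfVars_le {I : Ideal (MvPolynomial σ R)} {N : ℕ} :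
    homogeneousSubmodule σ R N ≤ I.restrictScalars R ↔ idealOfVars σ R ^ N ≤ I := by
  rw [homogeneousSubmodule_eq_span_monomial, Submodule.span_le, pow_idealOfVars_eq_span,
    Ideal.span_le]
  rfl

theorem span_inf_homogeneousSubmodule {e : ℕ} {S : Set (MvPolynomial σ R)}
    (hS : S ⊆ homogeneousSubmodule σ R e) (i : ℕ) :
    (Ideal.span S).restrictScalars R ⊓ homogeneousSubmodule σ R i =
      Submodule.span R
        (Set.image2 (fun m s => monomial m 1 * s) {m : σ →₀ ℕ | m.degree + e = i} S) := by
  have monomial_mul_mem (m : σ →₀ ℕ) {s} (hs : s ∈ S) :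
      monomial m 1 * s ∈ homogeneousSubmodule σ R (m.degree + e) :=
    (isHomogeneous_monomial 1 rfl).mul (hS hs)
  have span_monomials : Submodule.span R (Set.range fun m : σ →₀ ℕ => monomial m (1 : R)) = ⊤ := by
    rw [← coe_basisMonomials, (basisMonomials σ R).span_eq]
  refine le_antisymm ?_ (Submodule.span_le.2 ?_)
  · rintro g ⟨hg, hgi⟩
    rw [← homogeneousComponent_eq_self hgi]
    rw [SetLike.mem_coe, Ideal.span, ← Submodule.span_smul_of_span_eq_top span_monomials] at hg
    clear hgi
    induction hg using Submodule.span_induction with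
    | zero => simp
    | add x y _ _ hx hy => rw [map_add]; exact add_mem hx hy
    | smul c x _ hx => rw [map_smul]; exact Submodule.smul_mem _ c hx
    | mem x hx =>
      obtain ⟨_, ⟨m, rfl⟩, s, hs, rfl⟩ := hx
      simp only [smul_eq_mul]
      rw [homogeneousComponent_of_mem (monomial_mul_mem m hs)]
      split_ifs with h
      · exact Submodule.subset_span ⟨m, h.symm, s, hs, rfl⟩
      · exact zero_mem _
  · rintro _ ⟨m, rfl, s, hs, rfl⟩
    exact ⟨Ideal.mul_mem_left _ _ (Ideal.subset_span hs), monomial_mul_mem m hs⟩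

end HomogeneousPolynomials

section ZariskiOpen

theorem exists_eval_ne_zero_linearIndependent {K V W ι κ : Type*} [Field K] [AddCommGroup V]
    [Module K V] [AddCommGroup W] [Module K W] [Finite ι] [Finite κ] (b : Basis ι K V)
    (v : κ → V →ₗ[K] W) {x₀ : V} (h : LinearIndependent K fun j => v j x₀) :
    ∃ P : MvPolynomial ι K, eval (b.repr x₀) P ≠ 0 ∧
      ∀ x, eval (b.repr x) P ≠ 0 → LinearIndependent K fun j => v j x := by
  classical
  have := Fintype.ofFinite ι
  have := Fintype.ofFinite κ
  obtain ⟨L, hL⟩ := LinearMap.exists_leftInverse_of_injective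
    (Fintype.linearCombination K fun j => v j x₀)
    (LinearMap.ker_eq_bot.2 (linearIndependent_iff_injective_fintypeLinearCombination.1 h))
  let M : Matrix κ κ (MvPolynomial ι K) :=
    Matrix.of fun j => (L ∘ₗ v j).toMvPolynomial b (Pi.basisFun K κ)
  have eval_det (x : V) : eval (b.repr x) M.det = (Matrix.of fun j => L (v j x)).det := by
    rw [RingHom.map_det]
    congr 1
    ext i j
    simp [M, LinearMap.toMvPolynomial_eval_eq_apply]
  refine ⟨M.det, ?_, fun x hx => ?_⟩
  · have : (Matrix.of fun j => L (v j x₀)) = 1 := by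
      ext i j
      simpa [Fintype.linearCombination_apply_single, Matrix.one_apply, Pi.single_apply, eq_comm]
        using congrFun (LinearMap.congr_fun hL (Pi.single i 1)) j
    simp [eval_det, this]
  · rw [eval_det] at hx
    exact (Matrix.linearIndependent_rows_of_det_ne_zero hx).of_comp L

variable {n d : ℕ}

theorem isZariskiOpen_iff {U : Set (Forms n d)} :
    IsZariskiOpen U ↔ ∀ f ∈ U, ∃ P : MvPolynomial (Exponents n d) ℂ,
      eval ((homogeneousBasis _ ℂ d).repr f) P ≠ 0 ∧
        ∀ g, eval ((homogeneousBasis _ ℂ d).repr g) P ≠ 0 → g ∈ U := by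
  constructor
  · rintro ⟨S, hS⟩ f hf
    obtain ⟨P, hPS, hP⟩ := (hS f).1 hf
    exact ⟨P, hP, fun g hg => (hS g).2 ⟨P, hPS, hg⟩⟩
  · intro h
    exact ⟨{P | ∀ g, eval ((homogeneousBasis _ ℂ d).repr g) P ≠ 0 → g ∈ U},
      fun f => ⟨fun hf => (h f hf).imp fun _ => And.symm, fun ⟨_, hP, hf⟩ => hP f hf⟩⟩

theorem isZariskiOpen_univ : IsZariskiOpen (Set.univ : Set (Forms n d)) :=
  isZariskiOpen_iff.2 fun _ _ => ⟨1, by simp⟩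

theorem IsZariskiOpen.inter {U V : Set (Forms n d)} (hU : IsZariskiOpen U)
    (hV : IsZariskiOpen V) : IsZariskiOpen (U ∩ V) := by
  rw [isZariskiOpen_iff] at *
  rintro f ⟨hfU, hfV⟩
  obtain ⟨P, hPf, hP⟩ := hU f hfU
  obtain ⟨Q, hQf, hQ⟩ := hV f hfV
  refine ⟨P * Q, by simp [hPf, hQf], fun g hg => ?_⟩
  rw [map_mul] at hg
  exact ⟨hP g (left_ne_zero_of_mul hg), hQ g (right_ne_zero_of_mul hg)⟩

theorem IsZariskiOpen.inter_nonempty {U V : Set (Forms n d)} (hU : IsZariskiOpen U)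
    (hV : IsZariskiOpen V) (hU₀ : U.Nonempty) (hV₀ : V.Nonempty) : (U ∩ V).Nonempty := by
  obtain ⟨f, hf⟩ := hU₀
  obtain ⟨g, hg⟩ := hV₀
  obtain ⟨P, hPf, hP⟩ := isZariskiOpen_iff.1 hU f hf
  obtain ⟨Q, hQg, hQ⟩ := isZariskiOpen_iff.1 hV g hg
  have hPQ : P * Q ≠ 0 := mul_ne_zero (by rintro rfl; simp at hPf) (by rintro rfl; simp at hQg)
  obtain ⟨x, hx⟩ : ∃ x, eval x (P * Q) ≠ 0 := by
    by_contra! h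
    exact hPQ (MvPolynomial.funext fun x => by simpa using h x)
  have hx' : ⇑((homogeneousBasis _ ℂ d).repr ((homogeneousBasis _ ℂ d).equivFun.symm x)) = x :=
    (homogeneousBasis _ ℂ d).equivFun.apply_symm_apply x
  rw [← hx', map_mul] at hx
  exact ⟨_, hP _ (left_ne_zero_of_mul hx), hQ _ (right_ne_zero_of_mul hx)⟩

theorem isZariskiOpen_nonempty_biInter {ι : Type*} (s : Finset ι) {U : ι → Set (Forms n d)}
    (hU : ∀ i, IsZariskiOpen (U i)) (hU₀ : ∀ i, (U i).Nonempty) :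
    IsZariskiOpen (⋂ i ∈ s, U i) ∧ (⋂ i ∈ s, U i).Nonempty := by
  classical
  induction s using Finset.induction with
  | empty => simpa using isZariskiOpen_univ
  | insert i s _ ih =>
    rw [Finset.set_biInter_insert]
    exact ⟨(hU i).inter ih.1, (hU i).inter_nonempty ih.1 (hU₀ i) ih.2⟩

variable {W κ : Type*} [AddCommGroup W] [Module ℂ W] [Finite κ]

theorem isZariskiOpen_setOf_linearIndependent (v : κ → Forms n d →ₗ[ℂ] W) :
    IsZariskiOpen {f | LinearIndependent ℂ fun j => v j f} :=
  isZariskiOpen_iff.2 fun _ => exists_eval_ne_zero_linearIndependent (homogeneousBasis _ ℂ d) v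

theorem isZariskiOpen_setOf_le_finrank_span (v : κ → Forms n d →ₗ[ℂ] W) (r : ℕ) :
    IsZariskiOpen {f | r ≤ finrank ℂ (Submodule.span ℂ (Set.range fun j => v j f))} := by
  refine isZariskiOpen_iff.2 fun f (hf : r ≤ _) => ?_
  obtain ⟨ι, a, ha, hspan, hind⟩ := exists_linearIndependent' ℂ fun j => v j f
  have := Finite.of_injective a ha
  have := Fintype.ofFinite ι
  obtain ⟨P, hPf, hP⟩ := isZariskiOpen_iff.1
    (isZariskiOpen_setOf_linearIndependent fun i => v (a i)) f hind
  refine ⟨P, hPf, fun g hg => ?_⟩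
  have := FiniteDimensional.span_of_finite ℂ (Set.finite_range fun j => v j g)
  calc
    r ≤ Fintype.card ι := by rwa [← hspan, finrank_span_eq_card hind] at hf
    _ = finrank ℂ (Submodule.span ℂ (Set.range fun i => v (a i) g)) :=
      (finrank_span_eq_card (hP g hg)).symm
    _ ≤ finrank ℂ (Submodule.span ℂ (Set.range fun j => v j g)) :=
      Submodule.finrank_mono (Submodule.span_mono (Set.range_subset_iff.2 fun i => ⟨a i, rfl⟩))

end ZariskiOpen

section IteratedPartialDerivatives

variable {σ R : Type*} [CommRing R]

theorem commute_pderiv (i j : σ) :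
    Commute (pderiv i : Derivation R (MvPolynomial σ R) (MvPolynomial σ R)).toLinearMap
      (pderiv j : Derivation R (MvPolynomial σ R) (MvPolynomial σ R)).toLinearMap := by
  classical
  have lie_eq_zero :
      ⁅(pderiv i : Derivation R (MvPolynomial σ R) (MvPolynomial σ R)), pderiv j⁆ = 0 :=
    derivation_ext fun l => by
      rw [Derivation.commutator_apply]
      simp [pderiv_X, Pi.single_apply, apply_ite]
  rw [commute_iff_lie_eq, ← Derivation.commutator_coe_linear_map, lie_eq_zero]
  rfl

/-- The partial derivative `∂^α` for a multi-index `α`: the product, whose order is immaterial, of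
`α i` copies of `∂ / ∂x_i` for all `i`. -/
noncomputable def iteratedPderiv (α : σ →₀ ℕ) : Module.End R (MvPolynomial σ R) :=
  (α.toMultiset.map fun i => (pderiv i).toLinearMap).noncommProd <| by
    intro _ hD _ hE _
    obtain ⟨i, -, rfl⟩ := Multiset.mem_map.1 hD
    obtain ⟨j, -, rfl⟩ := Multiset.mem_map.1 hE
    exact commute_pderiv i j

@[simp]
theorem iteratedPderiv_zero (f : MvPolynomial σ R) : iteratedPderiv 0 f = f := by
  simp [iteratedPderiv]

theorem iteratedPderiv_single_add (i : σ) (α : σ →₀ ℕ) (f : MvPolynomial σ R) :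
    iteratedPderiv (Finsupp.single i 1 + α) f = pderiv i (iteratedPderiv α f) := by
  simp [iteratedPderiv]

theorem induction_single_add {p : (σ →₀ ℕ) → Prop} (α : σ →₀ ℕ) (zero : p 0)
    (single_add : ∀ i α, p α → p (Finsupp.single i 1 + α)) : p α := by
  classical
  rw [← Finsupp.toMultiset_toFinsupp α]
  induction α.toMultiset using Multiset.induction with
  | empty => simpa using zero
  | cons i s ih => simpa [← Multiset.singleton_add] using single_add i _ ih

theorem isHomogeneous_iteratedPderiv {d : ℕ} {f : MvPolynomial σ R} (hf : f.IsHomogeneous d)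
    (α : σ →₀ ℕ) : (iteratedPderiv α f).IsHomogeneous (d - α.degree) := by
  induction α using induction_single_add with
  | zero => simpa using hf
  | single_add i α ih =>
    rw [iteratedPderiv_single_add, map_add, Finsupp.degree_single, add_comm, ← Nat.sub_sub]
    exact ih.pderiv

variable [Fintype σ]

/-- The coefficient of `f` at `x^m / m!`, in terms of which `∂^α` is a shift of indices. -/
noncomputable def dividedCoeff (m : σ →₀ ℕ) : MvPolynomial σ R →ₗ[R] R :=
  ((∏ i, (m i).factorial : ℕ) : R) • lcoeff R m

theorem dividedCoeff_pderiv (m : σ →₀ ℕ) (i : σ) (f : MvPolynomial σ R) :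
    dividedCoeff m (pderiv i f) = dividedCoeff (m + Finsupp.single i 1) f := by
  classical
  have factorial_add_single :
      ∏ j, ((m + Finsupp.single i 1 : σ →₀ ℕ) j).factorial = (m i + 1) * ∏ j, (m j).factorial := by
    rw [Fintype.prod_eq_mul_prod_compl i, Fintype.prod_eq_mul_prod_compl i, ← mul_assoc]
    congr 1
    · simp [Nat.factorial_succ]
    · refine Finset.prod_congr rfl fun j hj => ?_
      simp [Finsupp.single_eq_of_ne (by simpa using hj : j ≠ i)]
  simp only [dividedCoeff, LinearMap.smul_apply, lcoeff_apply, smul_eq_mul, coeff_pderiv,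
    factorial_add_single]
  push_cast
  ring

theorem dividedCoeff_iteratedPderiv (m α : σ →₀ ℕ) (f : MvPolynomial σ R) :
    dividedCoeff m (iteratedPderiv α f) = dividedCoeff (m + α) f := by
  induction α using induction_single_add generalizing m with
  | zero => simp
  | single_add i α ih =>
    rw [iteratedPderiv_single_add, dividedCoeff_pderiv, ih, add_assoc]

end IteratedPartialDerivatives

section Apolarity

variable {σ K : Type*} [Field K] [Fintype σ]

/-- Macaulay's inverse system: through divided coefficients, forms of degree `d` are the linear
functionals on the space of forms of degree `d`. -/
theorem exists_dividedCoeff_eq [CharZero K] (φ : MvPolynomial σ K →ₗ[K] K) (d : ℕ) :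
    ∃ f : homogeneousSubmodule σ K d, ∀ m : σ →₀ ℕ, m.degree = d →
      dividedCoeff m (f : MvPolynomial σ K) = φ (monomial m 1) := by
  let f := (homogeneousBasis σ K d).equivFun.symm fun m =>
    ((∏ i, (m.1 i).factorial : ℕ) : K)⁻¹ * φ (monomial m.1 1)
  refine ⟨f, fun m hm => ?_⟩
  have coeff_f : coeff m (f : MvPolynomial σ K) = _ :=
    congrFun ((homogeneousBasis σ K d).equivFun.apply_symm_apply _) ⟨m, hm⟩
  have factorial_ne_zero : ((∏ i, (m i).factorial : ℕ) : K) ≠ 0 :=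
    Nat.cast_ne_zero.2 (Finset.prod_ne_zero_iff.2 fun i _ => (m i).factorial_ne_zero)
  rw [dividedCoeff, LinearMap.smul_apply, lcoeff_apply, coeff_f, smul_eq_mul,
    mul_inv_cancel_left₀ factorial_ne_zero]

/-- A relation `∑ c_α ∂^α f = 0` says that `q = ∑ c_α x^α` is apolar to `f`, that is, that the
functional `φ` represented by `f` vanishes on the multiples of `q`. -/
theorem linearIndependent_iteratedPderiv {R : Type*} [CommRing R] {k e : ℕ}
    {φ : MvPolynomial σ R →ₗ[R] R}
    (hφ : ∀ q ∈ homogeneousSubmodule σ R k,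
      (∀ g ∈ homogeneousSubmodule σ R e, φ (q * g) = 0) → q = 0)
    {f : MvPolynomial σ R}
    (hf : ∀ m : σ →₀ ℕ, m.degree = e + k → dividedCoeff m f = φ (monomial m 1)) :
    LinearIndependent R fun α : {α : σ →₀ ℕ // α.degree = k} => iteratedPderiv α.1 f := by
  have := Fintype.ofFinite {α : σ →₀ ℕ // α.degree = k}
  refine Fintype.linearIndependent_iff.2 fun c hc => ?_
  let q := (homogeneousBasis σ R k).equivFun.symm c
  have hq : (q : MvPolynomial σ R) = ∑ α, c α • monomial α.1 1 := by
    simp [q, Basis.equivFun_symm_apply]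
  have apolar : ∀ g ∈ homogeneousSubmodule σ R e, φ (q * g) = 0 := by
    intro g hg
    rw [homogeneousSubmodule_eq_span_monomial] at hg
    induction hg using Submodule.span_induction with
    | zero => simp
    | add g h _ _ hg hh => rw [mul_add, map_add, hg, hh, add_zero]
    | smul a g _ hg => rw [mul_smul_comm, map_smul, hg, smul_zero]
    | mem g hg =>
      obtain ⟨m, hm, rfl⟩ := hg
      calc
        φ ((q : MvPolynomial σ R) * monomial m 1) = ∑ α, c α • φ (monomial (m + α.1) 1) := by
          simp [hq, Finset.sum_mul, monomial_mul, add_comm m]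
        _ = ∑ α, c α • dividedCoeff m (iteratedPderiv α.1 f) :=
          Finset.sum_congr rfl fun α _ => by
            rw [dividedCoeff_iteratedPderiv, hf _ (by rw [map_add, hm, α.2])]
        _ = 0 := by simpa [map_sum] using congrArg (dividedCoeff m) hc
  have q_eq_zero : q = 0 := Subtype.ext (hφ q q.2 apolar)
  exact congrFun ((homogeneousBasis σ R k).equivFun.symm.map_eq_zero_iff.1 q_eq_zero)

theorem eq_zero_of_sum_eval_mul_eq_zero [DecidableEq σ] [Nonempty σ] {𝕜 : Type*} [RCLike 𝕜]
    {k e : ℕ} {q : MvPolynomial σ 𝕜} (hq : q ∈ homogeneousSubmodule σ 𝕜 k)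
    (h : ∀ g ∈ homogeneousSubmodule σ 𝕜 (k + e),
      ∑ p ∈ Fintype.piFinset fun _ : σ => Finset.Icc 1 (k + 1),
        eval (fun i => (p i : 𝕜)) (q * g) = 0) : q = 0 := by
  let i₀ := Classical.arbitrary σ
  let conj_q := MvPolynomial.map (starRingEnd 𝕜) q
  have eval_mul (p : σ → ℕ) : eval (fun i => (p i : 𝕜)) (q * (conj_q * X i₀ ^ e)) =
      ((‖eval (fun i => (p i : 𝕜)) q‖ ^ 2 * p i₀ ^ e : ℝ) : 𝕜) := by
    have eval_conj_q : eval (fun i => (p i : 𝕜)) conj_q =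
        starRingEnd 𝕜 (eval (fun i => (p i : 𝕜)) q) := by
      simp [conj_q, map_eval, Function.comp_def]
    simp [eval_conj_q, ← mul_assoc, RCLike.mul_conj]
  have sum_eq_zero := h (conj_q * X i₀ ^ e)
    ((IsHomogeneous.map hq (starRingEnd 𝕜)).mul (isHomogeneous_X_pow i₀ e))
  simp only [eval_mul] at sum_eq_zero
  norm_cast at sum_eq_zero
  have eval_q (p : σ → ℕ) (hp : ∀ i, p i ∈ Finset.Icc 1 (k + 1)) :
      eval (fun i => (p i : 𝕜)) q = 0 := by
    have := (Finset.sum_eq_zero_iff_of_nonneg fun p _ => by positivity).1 sum_eq_zero p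
      (Fintype.mem_piFinset.2 hp)
    have p_ne_zero : p i₀ ≠ 0 := Nat.one_le_iff_ne_zero.1 (Finset.mem_Icc.1 (hp i₀)).1
    simpa [p_ne_zero] using this
  refine eq_zero_of_eval_zero_at_prod_finset q
    (fun _ => (Finset.Icc 1 (k + 1)).map Nat.castEmbedding) (fun i => ?_) fun x hx => ?_
  · rw [Finset.card_map, Nat.card_Icc, Nat.add_sub_cancel, Nat.lt_succ_iff]
    exact (degreeOf_le_totalDegree q i).trans (IsHomogeneous.totalDegree_le hq)
  · choose p hp hpx using fun i => Finset.mem_map.1 (hx i)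
    obtain rfl : (fun i => (p i : 𝕜)) = x := funext hpx
    exact eval_q p hp

end Apolarity

theorem exists_linearIndependent_iteratedPderiv {σ 𝕜 : Type*} [Finite σ] [Nonempty σ] [RCLike 𝕜]
    {d k : ℕ} (hk : 2 * k ≤ d) :
    ∃ f : homogeneousSubmodule σ 𝕜 d, LinearIndependent 𝕜
      fun α : {α : σ →₀ ℕ // α.degree = k} => iteratedPderiv α.1 (f : MvPolynomial σ 𝕜) := by
  classical
  have := Fintype.ofFinite σ
  obtain ⟨e, rfl⟩ := Nat.exists_eq_add_of_le hk
  let φ : MvPolynomial σ 𝕜 →ₗ[𝕜] 𝕜 := ∑ p ∈ Fintype.piFinset fun _ : σ => Finset.Icc 1 (k + 1),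
    (aeval fun i => (p i : 𝕜)).toLinearMap
  obtain ⟨f, hf⟩ := exists_dividedCoeff_eq φ (2 * k + e)
  refine ⟨f, linearIndependent_iteratedPderiv (e := k + e) (φ := φ) (fun q hq h => ?_)
    fun m hm => hf m (by omega)⟩
  exact eq_zero_of_sum_eval_mul_eq_zero hq fun g hg => by
    simpa [φ, LinearMap.sum_apply, aeval_eq_eval] using h g hg

section JacobianIdeal

variable {n d k : ℕ}

theorem kthPartials_eq_range (f : Poly n) (k : ℕ) :
    kthPartials f k = Set.range fun α : Exponents n k => iteratedPderiv α.1 f := by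
  induction k with
  | zero =>
    ext g
    simp [kthPartials, Finsupp.degree_eq_zero_iff, eq_comm (a := f)]
  | succ k ih =>
    ext g
    constructor
    · rintro ⟨i, h, hh, rfl⟩
      obtain ⟨α, rfl⟩ := ih ▸ hh
      exact ⟨⟨Finsupp.single i 1 + α.1, by rw [map_add, Finsupp.degree_single, α.2, add_comm]⟩,
        iteratedPderiv_single_add i α.1 f⟩
    · rintro ⟨⟨α, hα⟩, rfl⟩
      obtain ⟨i, hi⟩ : ∃ i, α i ≠ 0 := by
        by_contra! h
        simp [show α = 0 from Finsupp.ext h] at hα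
      obtain ⟨β, rfl⟩ := exists_add_of_le (Finsupp.single_le_iff.2 (Nat.one_le_iff_ne_zero.2 hi))
      rw [map_add, Finsupp.degree_single, add_comm, Nat.add_right_cancel_iff] at hα
      exact ⟨i, _, ih ▸ ⟨⟨β, hα⟩, rfl⟩, iteratedPderiv_single_add i β f⟩

theorem kthPartials_subset_forms (f : Forms n d) (k : ℕ) :
    kthPartials (f : Poly n) k ⊆ Forms n (d - k) := by
  rw [kthPartials_eq_range]
  rintro _ ⟨⟨α, rfl⟩, rfl⟩
  exact isHomogeneous_iteratedPderiv f.2 α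

theorem finrank_map_mk_add_finrank_inf {K A : Type*} [Field K] [CommRing A] [Algebra K A]
    (I : Ideal A) (V : Submodule K A) [FiniteDimensional K V] :
    finrank K (V.map (Ideal.Quotient.mkₐ K I).toLinearMap) +
      finrank K ↥(I.restrictScalars K ⊓ V) = finrank K V := by
  have ker_eq : (Ideal.Quotient.mkₐ K I).toLinearMap.ker = I.restrictScalars K := by
    ext x
    exact Ideal.Quotient.eq_zero_iff_mem
  have := LinearMap.finrank_range_add_finrank_ker
    ((Ideal.Quotient.mkₐ K I).toLinearMap.domRestrict V)
  rwa [LinearMap.range_domRestrict, LinearMap.ker_domRestrict, ker_eq,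
    ← Submodule.finrank_map_subtype_eq, Submodule.map_comap_subtype, inf_comm] at this

/-- The degree `i` part of the Jacobian ideal `Jᵏ(f)`. -/
noncomputable def jacobianPart (k : ℕ) (f : Poly n) (i : ℕ) : Submodule ℂ (Poly n) :=
  (jacobianIdeal k f).restrictScalars ℂ ⊓ Forms n i

theorem hilb_add_finrank_jacobianPart (k : ℕ) (f : Poly n) (i : ℕ) :
    hilb k f i + finrank ℂ (jacobianPart k f i) = (n + i).choose n := by
  rw [← finrank_forms]
  exact finrank_map_mk_add_finrank_inf _ _

theorem jacobianPart_eq_span (f : Forms n d) (k i : ℕ) :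
    jacobianPart k (f : Poly n) i = Submodule.span ℂ (Set.image2 (fun m s => monomial m 1 * s)
      {m | m.degree + (d - k) = i} (kthPartials (f : Poly n) k)) :=
  span_inf_homogeneousSubmodule (kthPartials_subset_forms f k) i

theorem jacobianPart_eq_bot (f : Forms n d) {i : ℕ} (hi : i < d - k) :
    jacobianPart k (f : Poly n) i = ⊥ := by
  have no_monomials : {m : Fin (n + 1) →₀ ℕ | m.degree + (d - k) = i} = ∅ :=
    Set.eq_empty_of_forall_notMem fun m (hm : _ = i) => by omega
  rw [jacobianPart_eq_span, no_monomials, Set.image2_empty_left, Submodule.span_empty]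

theorem jacobianPart_sub_eq_span (f : Forms n d) (k : ℕ) :
    jacobianPart k (f : Poly n) (d - k) = Submodule.span ℂ (kthPartials (f : Poly n) k) := by
  have only_one : {m : Fin (n + 1) →₀ ℕ | m.degree + (d - k) = d - k} = {0} := by
    ext m
    simp [Finsupp.degree_eq_zero_iff]
  rw [jacobianPart_eq_span, only_one, Set.image2_singleton_left]
  simp

theorem isZariskiOpen_setOf_le_finrank_jacobianPart (k i r : ℕ) :
    IsZariskiOpen {f : Forms n d | r ≤ finrank ℂ (jacobianPart k (f : Poly n) i)} := by
  have : Finite {m : Fin (n + 1) →₀ ℕ | m.degree + (d - k) = i} :=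
    (Finsupp.finite_of_degree_le i).subset fun m (hm : _ = i) =>
      (le_self_add.trans_eq hm : m.degree ≤ i)
  let v (p : {m : Fin (n + 1) →₀ ℕ | m.degree + (d - k) = i} × Exponents n k) :
      Forms n d →ₗ[ℂ] Poly n :=
    LinearMap.mulLeft ℂ (monomial p.1.1 1) ∘ₗ iteratedPderiv p.2.1 ∘ₗ (Forms n d).subtype
  have jacobianPart_eq_span_range (f : Forms n d) :
      jacobianPart k (f : Poly n) i = Submodule.span ℂ (Set.range fun p => v p f) := by
    conv_lhs => rw [jacobianPart_eq_span, kthPartials_eq_range,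
      ← Subtype.range_coe (s := {m : Fin (n + 1) →₀ ℕ | _}), Set.image2_range]
    rfl
  have same_set : {f : Forms n d | r ≤ finrank ℂ (jacobianPart k (f : Poly n) i)} =
      {f | r ≤ finrank ℂ (Submodule.span ℂ (Set.range fun p => v p f))} :=
    Set.ext fun f => by rw [Set.mem_ofPred_eq, jacobianPart_eq_span_range, Set.mem_ofPred_eq]
  rw [same_set]
  exact isZariskiOpen_setOf_le_finrank_span v r

end JacobianIdeal

section Fermat

theorem pderiv_fermat (n d : ℕ) (i : Fin (n + 1)) :
    pderiv i (fermat n d : Poly n) = d • X i ^ (d - 1) := by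
  simp [fermat, pderiv_X, Pi.single_apply]

theorem exists_eq_smul_of_mem_kthPartials_fermat {n d k : ℕ} {g : Poly n}
    (hg : g ∈ kthPartials (fermat n d : Poly n) (k + 1)) :
    ∃ (i : Fin (n + 1)) (c : ℕ), g = c • X i ^ (d - (k + 1)) := by
  induction k generalizing g with
  | zero =>
    obtain ⟨i, _, rfl, rfl⟩ := hg
    exact ⟨i, d, pderiv_fermat n d i⟩
  | succ k ih =>
    obtain ⟨i, h, hh, rfl⟩ := hg
    obtain ⟨j, c, rfl⟩ := ih hh
    refine ⟨j, if i = j then c * (d - (k + 1)) else 0, ?_⟩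
    split_ifs with hij
    · subst hij
      simp [Nat.sub_sub, mul_assoc]
    · simp [pderiv_X_of_ne (Ne.symm hij)]

theorem descFactorial_smul_X_pow_mem_kthPartials_fermat (n d k : ℕ) (i : Fin (n + 1)) :
    d.descFactorial (k + 1) • X i ^ (d - (k + 1)) ∈
      kthPartials (fermat n d : Poly n) (k + 1) := by
  induction k with
  | zero => exact ⟨i, _, rfl, by simp [pderiv_fermat]⟩
  | succ k ih =>
    refine ⟨i, _, ih, ?_⟩
    rw [Nat.descFactorial_succ, map_nsmul, Derivation.leibniz_pow, pderiv_X_self, smul_eq_mul,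
      mul_one, smul_smul, Nat.sub_sub, mul_comm]

theorem finrank_jacobianPart_fermat_le (n d k : ℕ) :
    finrank ℂ (jacobianPart (k + 1) (fermat n d : Poly n) (d - (k + 1))) ≤ n + 1 := by
  have span_le : Submodule.span ℂ (kthPartials (fermat n d : Poly n) (k + 1)) ≤
      Submodule.span ℂ (Set.range fun i : Fin (n + 1) => (X i ^ (d - (k + 1)) : Poly n)) :=
    Submodule.span_le.2 fun g hg => by
      obtain ⟨i, c, rfl⟩ := exists_eq_smul_of_mem_kthPartials_fermat hg
      exact nsmul_mem (Submodule.subset_span (Set.mem_range_self i)) c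
  have := FiniteDimensional.span_of_finite ℂ
    (Set.finite_range fun i : Fin (n + 1) => (X i ^ (d - (k + 1)) : Poly n))
  rw [jacobianPart_sub_eq_span]
  exact (Submodule.finrank_mono span_le).trans
    ((finrank_range_le_card _).trans_eq (Fintype.card_fin _))

theorem exists_pow_idealOfVars_le_jacobianIdeal_fermat {n d k : ℕ} (hk : k + 1 ≤ d) :
    ∃ N, idealOfVars (Fin (n + 1)) ℂ ^ N ≤ jacobianIdeal (k + 1) (fermat n d : Poly n) := by
  refine Ideal.exists_pow_le_of_le_radical_of_fg (Ideal.span_le.2 ?_) (idealOfVars_fg _ _)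
  rintro _ ⟨i, rfl⟩
  have descFactorial_ne_zero : ((d.descFactorial (k + 1) : ℕ) : ℂ) ≠ 0 :=
    Nat.cast_ne_zero.2 (Nat.descFactorial_eq_zero_iff_lt.not.2 hk.not_gt)
  have smul_mem : ((d.descFactorial (k + 1) : ℕ) : ℂ) • (X i ^ (d - (k + 1)) : Poly n) ∈
      (jacobianIdeal (k + 1) (fermat n d : Poly n)).restrictScalars ℂ := by
    rw [Nat.cast_smul_eq_nsmul]
    exact Ideal.subset_span (descFactorial_smul_X_pow_mem_kthPartials_fermat n d k i)
  exact Ideal.mem_radical_iff.2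
    ⟨d - (k + 1), (Submodule.smul_mem_iff _ descFactorial_ne_zero).1 smul_mem⟩

end Fermat

section GenericLocus

variable {n d k : ℕ}

/-- The forms `f` of degree `d` for which `dim Jᵏ(f)_i` is as large as possible. -/
def maxRankLocus (n d k i : ℕ) : Set (Forms n d) :=
  {f | ∀ g : Forms n d,
    finrank ℂ (jacobianPart k (g : Poly n) i) ≤ finrank ℂ (jacobianPart k (f : Poly n) i)}

theorem maxRankLocus_nonempty (n d k i : ℕ) : (maxRankLocus n d k i).Nonempty := by
  let f := Function.argmin fun f : Forms n d => hilb k (f : Poly n) i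
  refine ⟨f, fun g => ?_⟩
  have hilb_le : hilb k (f : Poly n) i ≤ hilb k (g : Poly n) i :=
    Function.argmin_le (fun f : Forms n d => hilb k (f : Poly n) i) g
  have hf := hilb_add_finrank_jacobianPart k (f : Poly n) i
  have hg := hilb_add_finrank_jacobianPart k (g : Poly n) i
  omega

theorem isZariskiOpen_maxRankLocus (n d k i : ℕ) : IsZariskiOpen (maxRankLocus n d k i) := by
  obtain ⟨f₀, hf₀⟩ := maxRankLocus_nonempty n d k i
  convert isZariskiOpen_setOf_le_finrank_jacobianPart k i
    (finrank ℂ (jacobianPart k (f₀ : Poly n) i))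
  exact Set.ext fun f => ⟨fun hf => hf f₀, fun hf g => (hf₀ g).trans hf⟩

theorem finrank_jacobianPart_eq_of_mem_maxRankLocus {i : ℕ} {f g : Forms n d}
    (hf : f ∈ maxRankLocus n d k i) (hg : g ∈ maxRankLocus n d k i) :
    finrank ℂ (jacobianPart k (f : Poly n) i) = finrank ℂ (jacobianPart k (g : Poly n) i) :=
  le_antisymm (hg f) (hf g)

theorem hilb_eq_iff {f g : Poly n} : hilb k f = hilb k g ↔
    ∀ i, finrank ℂ (jacobianPart k f i) = finrank ℂ (jacobianPart k g i) := by
  rw [funext_iff]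
  refine forall_congr' fun i => ?_
  have hf := hilb_add_finrank_jacobianPart k f i
  have hg := hilb_add_finrank_jacobianPart k g i
  omega

theorem jacobianPart_eq_forms_iff {f : Poly n} {i : ℕ} :
    jacobianPart k f i = Forms n i ↔ idealOfVars (Fin (n + 1)) ℂ ^ i ≤ jacobianIdeal k f := by
  rw [jacobianPart, inf_eq_right, homogeneousSubmodule_le_iff_pow_idealOfVars_le]

theorem pow_idealOfVars_le_jacobianIdeal_of_mem_maxRankLocus {N : ℕ} {f g : Forms n d}
    (hf : f ∈ maxRankLocus n d k N)
    (hg : idealOfVars (Fin (n + 1)) ℂ ^ N ≤ jacobianIdeal k (g : Poly n)) :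
    idealOfVars (Fin (n + 1)) ℂ ^ N ≤ jacobianIdeal k (f : Poly n) := by
  rw [← jacobianPart_eq_forms_iff] at hg ⊢
  exact Submodule.eq_of_le_of_finrank_le inf_le_right (hg ▸ hf g)

theorem exists_isGenericLocus_succ (hk : k + 1 ≤ d) :
    ∃ U : Set (Forms n d), IsGenericLocus (k + 1) U := by
  obtain ⟨N, hN⟩ := exists_pow_idealOfVars_le_jacobianIdeal_fermat (n := n) hk
  obtain ⟨hopen, hnonempty⟩ := isZariskiOpen_nonempty_biInter (Finset.range (N + 1))
    (isZariskiOpen_maxRankLocus n d (k + 1)) (maxRankLocus_nonempty n d (k + 1))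
  refine ⟨_, hopen, hnonempty, fun f hf g hg => hilb_eq_iff.2 fun i => ?_⟩
  simp only [Set.mem_iInter, Finset.mem_range, Nat.lt_succ_iff] at hf hg
  rcases le_total i N with hi | hi
  · exact finrank_jacobianPart_eq_of_mem_maxRankLocus (hf i hi) (hg i hi)
  · have jacobianPart_eq_forms {h : Forms n d} (hh : h ∈ maxRankLocus n d (k + 1) N) :
        jacobianPart (k + 1) (h : Poly n) i = Forms n i :=
      jacobianPart_eq_forms_iff.2 <| (Ideal.pow_le_pow_right hi).trans
        (pow_idealOfVars_le_jacobianIdeal_of_mem_maxRankLocus hh hN)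
    rw [jacobianPart_eq_forms (hf N le_rfl), jacobianPart_eq_forms (hg N le_rfl)]

theorem finrank_jacobianPart_zero {f : Forms n d} (hf : f ≠ 0) (i : ℕ) :
    finrank ℂ (jacobianPart 0 (f : Poly n) i) =
      finrank ℂ (Submodule.span ℂ ((fun m => monomial m (1 : ℂ)) ''
        {m : Fin (n + 1) →₀ ℕ | m.degree + d = i})) := by
  have mulRight_injective : Function.Injective (LinearMap.mulRight ℂ (f : Poly n)) :=
    mul_left_injective₀ (Subtype.coe_ne_coe.2 hf)
  have jacobianPart_eq_map : jacobianPart 0 (f : Poly n) i =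
      (Submodule.span ℂ ((fun m => monomial m (1 : ℂ)) ''
        {m : Fin (n + 1) →₀ ℕ | m.degree + d = i})).map (LinearMap.mulRight ℂ (f : Poly n)) := by
    rw [jacobianPart_eq_span, kthPartials, Set.image2_singleton_right, Submodule.map_span,
      Set.image_image]
    rfl
  rw [jacobianPart_eq_map]
  exact (Submodule.equivMapOfInjective _ mulRight_injective _).finrank_eq.symm

theorem exists_isGenericLocus_zero (n d : ℕ) : ∃ U : Set (Forms n d), IsGenericLocus 0 U := by
  refine ⟨{f | f ≠ 0}, ?_, ?_, fun f hf g hg => hilb_eq_iff.2 fun i => ?_⟩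
  · simpa [linearIndependent_unique_iff] using
      isZariskiOpen_setOf_linearIndependent fun _ : Unit => LinearMap.id (M := Forms n d)
  · have := nontrivial_of_finrank_pos (R := ℂ) (M := Forms n d)
      (by rw [finrank_forms]; exact Nat.choose_pos (Nat.le_add_right n d))
    exact exists_ne 0
  · rw [finrank_jacobianPart_zero hf, finrank_jacobianPart_zero hg]

theorem IsGenericLocus.hilb_sub_add_choose (hk : 2 * k ≤ d) {U : Set (Forms n d)}
    (hU : IsGenericLocus k U) {f : Forms n d} (hf : f ∈ U) :
    hilb k (f : Poly n) (d - k) + (n + k).choose n = (n + (d - k)).choose n := by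
  let partials (α : Exponents n k) : Forms n d →ₗ[ℂ] Poly n :=
    iteratedPderiv α.1 ∘ₗ (Forms n d).subtype
  have independent_nonempty : {f | LinearIndependent ℂ fun α => partials α f}.Nonempty :=
    exists_linearIndependent_iteratedPderiv hk
  obtain ⟨g, hgU, hg⟩ := hU.1.inter_nonempty
    (isZariskiOpen_setOf_linearIndependent partials) hU.2.1 independent_nonempty
  have := Fintype.ofFinite (Exponents n k)
  have finrank_g := calc
    finrank ℂ (jacobianPart k (g : Poly n) (d - k))
    _ = finrank ℂ (Submodule.span ℂ (Set.range fun α => partials α g)) := by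
      rw [jacobianPart_sub_eq_span, kthPartials_eq_range]
      rfl
    _ = Fintype.card (Exponents n k) := finrank_span_eq_card hg
    _ = (n + k).choose n := by
      rw [← finrank_forms, finrank_eq_card_basis (homogeneousBasis _ ℂ k)]
  have milnor := hilb_add_finrank_jacobianPart k (g : Poly n) (d - k)
  rwa [finrank_g, ← hU.2.2 f hf g hgU] at milnor

theorem succ_lt_add_choose {n k : ℕ} (hn : 1 ≤ n) (hk : 2 ≤ k) : n + 1 < (n + k).choose n := by
  calc
    n + 1 < (n + 1) + (n + 1).choose 2 := Nat.lt_add_of_pos_right (Nat.choose_pos (by omega))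
    _ = (n + 2).choose 2 := by rw [Nat.choose_succ_succ' (n + 1), Nat.choose_one_right]
    _ = (n + 2).choose n := Nat.choose_symm_add.symm
    _ ≤ (n + k).choose n := Nat.choose_le_choose n (by omega)

theorem IsGenericLocus.fermat_notMem (hn : 1 ≤ n) (hk₂ : 2 ≤ k) (hk : 2 * k ≤ d)
    {U : Set (Forms n d)} (hU : IsGenericLocus k U) : fermat n d ∉ U := by
  intro hmem
  obtain ⟨k, rfl⟩ := Nat.exists_eq_add_of_le' (one_le_two.trans hk₂)
  have initial := hU.hilb_sub_add_choose hk hmem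
  have milnor := hilb_add_finrank_jacobianPart (k + 1) (fermat n d : Poly n) (d - (k + 1))
  have := finrank_jacobianPart_fermat_le n d k
  have := succ_lt_add_choose hn hk₂
  omega

end GenericLocus

end HigherMilnor

theorem corollary3p4 (n d k : ℕ) (hk : 2 * k ≤ d) :
    (∃ U : Set (Forms n d), IsGenericLocus k U) ∧
    ∀ U : Set (Forms n d), IsGenericLocus k U →
      (∀ f ∈ U,
        (∀ i : ℕ, i < d - k → hilb k (f : Poly n) i = (n + i).choose n) ∧
        (hilb k (f : Poly n) (d - k) : ℤ)
          = (Module.finrank ℂ (Forms n (d - k)) : ℤ) - (Module.finrank ℂ (Forms n k) : ℤ) ∧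
        (hilb k (f : Poly n) (d - k) : ℤ)
          = ((n + (d - k)).choose n : ℤ) - ((n + k).choose n : ℤ)) ∧
      (1 ≤ n → 2 ≤ k → fermat n d ∉ U) := by
  constructor
  · cases k with
    | zero => exact exists_isGenericLocus_zero n d
    | succ k => exact exists_isGenericLocus_succ (by omega)
  intro U hU
  refine ⟨fun f hf => ?_, fun hn hk₂ => hU.fermat_notMem hn hk₂ hk⟩
  have hilb_add := hU.hilb_sub_add_choose hk hf
  rw [finrank_forms, finrank_forms]
  refine ⟨fun i hi => ?_, by omega, by omega⟩
  rw [← hilb_add_finrank_jacobianPart, jacobianPart_eq_bot f hi, finrank_bot, add_zero]
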